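/- Conventions. A weighted polyhedral complex $X\subset\mathbb{R}^2$ pure of dimension $1$ is a finite polyhedral complex in $\mathbb{R}^2$ (possibly empty), every cell of which is contained in a $1$-dimensional cell and none of which has dimension $2$, together with a weight $w_X(\sigma)>0$ for each $1$-dimensional (maximal) cell $\sigma$. It is balanced if at every vertex $p$ one has $\sum_{\sigma\ni p}w_X(\sigma)\,u_{\sigma,p}=0$, the sum being over the maximal cells $\sigma$ containing $p$, where $u_{\sigma,p}$ is the Euclidean unit vector pointing from $p$ into $\sigma$. The monomial length $\mathrm{mlen}(X)$ of a balanced $X$ is the number of connected components of $\mathbb{R}^2\setminus |X|$. A sum of weighted complexes is their union with the weights added, after passing to a common refinement. If a balanced complex is presented as a sum (a factorization) $Y=Y_1+\dots+Y_m$ of balanced complexes $Y_i$, its factorization length is $$\mathrm{flen}(Y)=\sum_{i=1}^m \mathrm{mlen}(Y_i)-(m-1).$$ A balancing of $X$ with respect to the factorization length is a balanced complex $Y=Y_1+\dots+Y_m$ so presented with $w_X\le w_Y$ on every maximal cell of a common refinement of $X$ and $Y$ (where $w_Y=0$ off $Y$, so that $|X|\subset|Y|$); it is minimal if $\mathrm{flen}(Y)\le\mathrm{flen}(Z)$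 for every such balancing $Z=Z_1+\dots+Z_k$ of $X$. The canonical arrangement $\mathcal{A}_X$ is the sum $L_1+\dots+L_k$ of the distinct lines $L_1,\dots,L_k$ that are affine spans of maximal cells of $X$, presented by this factorization, each $L_j$ being weighted by the maximum of the weights of the maximal cells of $X$ lying on $L_j$. Proposition. Let $X\subset\mathbb{R}^2$ be a weighted polyhedral complex pure of dimension $1$ (with positive weights), and let $\mathcal{V}$ be a minimal balancing of $X$ with respect to the factorization length. Then $$\mathrm{flen}(\mathcal{A}_X)\le 3\,\mathrm{flen}(\mathcal{V}).$$ -/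

import Mathlib

namespace PlaneComplex

open Filter

/-- The Euclidean plane. -/
abbrev Plane : Type := EuclideanSpace ℝ (Fin 2)

/-- A polyhedron: the intersection of finitely many closed half-planes `⟪a, x⟫ ≤ b`. -/
def IsPolyhedron (P : Set Plane) : Prop :=
  ∃ H : Finset (Plane × ℝ), P = {x | ∀ h ∈ H, inner ℝ h.1 x ≤ h.2}

/-- The dimension of (the affine span of) a nonempty set. -/
noncomputable def dim (P : Set Plane) : ℕ := Module.finrank ℝ (vectorSpan ℝ P)

/-- A weighted polyhedral complex in the plane, pure of dimension `1`, with positive weights: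
a finite set of nonempty polyhedra that is closed under taking nonempty faces and in which
any two cells that meet do so in a common face. (A nonempty face is the locus where a linear
functional attains its maximum, i.e. a nonempty exposed subset.) Only the values of `weight` on
the one-dimensional cells are ever used. The complex may be empty. -/
structure WeightedComplex where
  cells : Finset (Set Plane)
  isPolyhedron : ∀ P ∈ cells, IsPolyhedron P
  nonempty : ∀ P ∈ cells, P.Nonempty
  face_mem : ∀ P ∈ cells, ∀ F : Set Plane, F.Nonempty → IsExposed ℝ P F → F ∈ cells
  inter_face : ∀ P ∈ cells, ∀ Q ∈ cells, (P ∩ Q).Nonempty →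
    IsExposed ℝ P (P ∩ Q) ∧ IsExposed ℝ Q (P ∩ Q)
  dim_le : ∀ P ∈ cells, dim P ≤ 1
  isPure : ∀ P ∈ cells, ∃ Q ∈ cells, P ⊆ Q ∧ dim Q = 1
  weight : Set Plane → ℝ
  weight_pos : ∀ P ∈ cells, dim P = 1 → 0 < weight P

namespace WeightedComplex

open Classical in
/-- The maximal cells, i.e. the one-dimensional ones. -/
noncomputable def maxCells (X : WeightedComplex) : Finset (Set Plane) :=
  {P ∈ X.cells | dim P = 1}

/-- The support: the union of the maximal cells. -/
def support (X : WeightedComplex) : Set Plane := ⋃ P ∈ X.maxCells, P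

open Classical in
/-- The weight of a complex at a point. Off the finitely many vertices this is the weight of the
unique maximal cell containing `x`, and `0` if there is none. -/
noncomputable def weightAt (X : WeightedComplex) (x : Plane) : ℝ :=
  ∑ P ∈ X.maxCells with x ∈ P, X.weight P

open Classical in
/-- The balancing condition: at every vertex `p`, the primitive (unit) vectors pointing from `p`
into the adjacent maximal cells, multiplied by the weights of these cells, add up to zero.
(As `p` is an endpoint of each of these cells, the unit vectors are uniquely determined.) -/
def IsBalanced (X : WeightedComplex) : Prop :=
  ∀ p : Plane, {p} ∈ X.cells → ∃ u : Set Plane → Plane,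
    (∀ P ∈ X.maxCells, p ∈ P → ‖u P‖ = 1 ∧ ∃ t : ℝ, 0 < t ∧ p + t • u P ∈ P) ∧
    ∑ P ∈ X.maxCells with p ∈ P, X.weight P • u P = 0

/-- The monomial length: the number of regions (connected components of the complement of the
support) into which the complex divides the plane. -/
noncomputable def mlen (X : WeightedComplex) : ℕ :=
  Nat.card (ConnectedComponents ↥(X.supportᶜ))

end WeightedComplex

/-- A balanced complex presented as a sum `Y₁ + ⋯ + Yₘ` of balanced complexes
(a factorization). -/
structure Factorization where
  factors : Multiset WeightedComplex
  balanced : ∀ Y ∈ factors, Y.IsBalanced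

namespace Factorization

/-- The weight of the sum `Y₁ + ⋯ + Yₘ` at a point (meaningful off finitely many points): the
weight function of a sum is the sum of the weight functions on a common refinement. -/
noncomputable def weightAt (Y : Factorization) (x : Plane) : ℝ :=
  (Y.factors.map fun Z => Z.weightAt x).sum

/-- The factorization length `∑ᵢ mlen Yᵢ - (m - 1)`. -/
noncomputable def flen (Y : Factorization) : ℤ :=
  (Y.factors.map fun Z => (Z.mlen : ℤ)).sum - ((Multiset.card Y.factors : ℤ) - 1)

/-- `Y = Y₁ + ⋯ + Yₘ` is a balancing of `X`: `w_X ≤ w_Y` on every maximal cell of a common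
refinement, i.e. at all but finitely many points of the plane. -/
def IsBalancingOf (Y : Factorization) (X : WeightedComplex) : Prop :=
  ∀ᶠ x in cofinite, X.weightAt x ≤ Y.weightAt x

/-- A minimal balancing with respect to the factorization length. -/
def IsMinimalBalancingOf (Y : Factorization) (X : WeightedComplex) : Prop :=
  Y.IsBalancingOf X ∧ ∀ Z : Factorization, Z.IsBalancingOf X → Y.flen ≤ Z.flen

end Factorization

theorem dim_line {L : AffineSubspace ℝ Plane} :
    dim (L : Set Plane) = Module.finrank ℝ L.direction := by
  rw [dim, AffineSubspace.direction_eq_vectorSpan]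

theorem nonempty_line {L : AffineSubspace ℝ Plane}
    (hL : Module.finrank ℝ L.direction = 1) : (L : Set Plane).Nonempty := by
  rw [AffineSubspace.nonempty_iff_ne_bot]
  rintro rfl
  rw [AffineSubspace.direction_bot, finrank_bot] at hL
  exact zero_ne_one hL

theorem eq_of_isExposed_line {L : AffineSubspace ℝ Plane} {F : Set Plane}
    (hF : F.Nonempty) (h : IsExposed ℝ (L : Set Plane) F) : F = L := by
  obtain ⟨l, rfl⟩ := h hF
  obtain ⟨x, hx, hmax⟩ := hF
  have key : ∀ y ∈ L, l y = l x := by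
    intro y hy
    apply le_antisymm (hmax y hy)
    have h2 : (x -ᵥ y) +ᵥ x ∈ L :=
      AffineSubspace.vadd_mem_of_mem_direction (L.vsub_mem_direction hx hy) hx
    have h3 := hmax _ h2
    simp only [vsub_eq_sub, vadd_eq_add, map_add, map_sub] at h3
    linarith
  ext y
  simp only [Set.mem_ofPred_eq, SetLike.mem_coe]
  constructor
  · exact fun hy => hy.1
  · exact fun hy => ⟨hy, fun z hz => by rw [key y hy, key z hz]⟩

theorem isPolyhedron_line {L : AffineSubspace ℝ Plane}
    (hL : Module.finrank ℝ L.direction = 1) : IsPolyhedron (L : Set Plane) := by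
  classical
  obtain ⟨p, hp⟩ := nonempty_line hL
  have h1 : Module.finrank ℝ L.directionᗮ = 1 := by
    have := L.direction.finrank_add_finrank_orthogonal
    rw [hL, finrank_euclideanSpace_fin] at this
    omega
  obtain ⟨n, -, hn⟩ := finrank_eq_one_iff'.mp h1
  have hmem : ∀ v : Plane, v ∈ L.direction ↔ inner ℝ (n : Plane) v = 0 := by
    intro v
    constructor
    · intro hv
      exact Submodule.inner_left_of_mem_orthogonal hv n.2
    · intro hv
      rw [← Submodule.orthogonal_orthogonal L.direction, Submodule.mem_orthogonal]
      intro w hw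
      obtain ⟨c, hc⟩ := hn ⟨w, hw⟩
      have : w = c • (n : Plane) := by
        rw [← Submodule.coe_smul, hc]
      rw [this, inner_smul_left, hv, mul_zero]
  refine ⟨{((n : Plane), inner ℝ (n : Plane) p), (-(n : Plane), -inner ℝ (n : Plane) p)}, ?_⟩
  ext x
  have hx : x ∈ L ↔ x -ᵥ p ∈ L.direction :=
    (AffineSubspace.vsub_right_mem_direction_iff_mem hp x).symm
  simp only [SetLike.mem_coe, Set.mem_ofPred_eq, Finset.mem_insert, Finset.mem_singleton,
    forall_eq_or_imp, forall_eq, inner_neg_left, hx, hmem, vsub_eq_sub, inner_sub_right]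
  constructor
  · intro h
    constructor <;> linarith
  · rintro ⟨h2, h3⟩
    linarith

/-- A line with a positive weight, as a complex with a single cell. -/
def lineComplex (L : AffineSubspace ℝ Plane) (hL : Module.finrank ℝ L.direction = 1)
    (w : ℝ) (hw : 0 < w) : WeightedComplex where
  cells := {(L : Set Plane)}
  isPolyhedron P hP := by
    rw [Finset.mem_singleton.mp hP]
    exact isPolyhedron_line hL
  nonempty P hP := by
    rw [Finset.mem_singleton.mp hP]
    exact nonempty_line hL
  face_mem P hP F hF h := by
    rw [Finset.mem_singleton] at hP ⊢
    subst hP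
    exact eq_of_isExposed_line hF h
  inter_face P hP Q hQ _ := by
    rw [Finset.mem_singleton] at hP hQ
    subst hP hQ
    rw [Set.inter_self]
    exact ⟨IsExposed.refl _, IsExposed.refl _⟩
  dim_le P hP := by
    rw [Finset.mem_singleton.mp hP, dim_line, hL]
  isPure P hP := ⟨P, hP, subset_rfl, by rw [Finset.mem_singleton.mp hP, dim_line, hL]⟩
  weight _ := w
  weight_pos _ _ _ := hw

theorem lineComplex_isBalanced (L : AffineSubspace ℝ Plane)
    (hL : Module.finrank ℝ L.direction = 1) (w : ℝ) (hw : 0 < w) :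
    (lineComplex L hL w hw).IsBalanced := by
  intro p hp
  exfalso
  have h : ({p} : Set Plane) = L := Finset.mem_singleton.mp hp
  have h2 : dim ({p} : Set Plane) = 1 := by rw [h, dim_line, hL]
  rw [dim, vectorSpan_singleton, finrank_bot] at h2
  exact zero_ne_one h2

namespace WeightedComplex

open Classical in
/-- The set of the (pairwise distinct) lines that are affine spans of maximal cells. -/
noncomputable def spanLines (X : WeightedComplex) : Finset (AffineSubspace ℝ Plane) :=
  X.maxCells.image (affineSpan ℝ)

theorem finrank_of_mem_spanLines {X : WeightedComplex} {L : AffineSubspace ℝ Plane}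
    (hL : L ∈ X.spanLines) : Module.finrank ℝ L.direction = 1 := by
  classical
  obtain ⟨P, hP, rfl⟩ := Finset.mem_image.mp hL
  rw [direction_affineSpan]
  exact (Finset.mem_filter.mp hP).2

open Classical in
/-- The maximal cells that lie on, and hence span, a given line. -/
noncomputable def cellsOn (X : WeightedComplex) (L : AffineSubspace ℝ Plane) :
    Finset (Set Plane) :=
  {P ∈ X.maxCells | affineSpan ℝ P = L}

theorem cellsOn_nonempty {X : WeightedComplex} {L : AffineSubspace ℝ Plane}
    (hL : L ∈ X.spanLines) : (X.cellsOn L).Nonempty := by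
  classical
  obtain ⟨P, hP, h⟩ := Finset.mem_image.mp hL
  exact ⟨P, Finset.mem_filter.mpr ⟨hP, h⟩⟩

/-- The weight of a line of the canonical arrangement: the largest weight of a maximal cell
on it. -/
noncomputable def lineWeight (X : WeightedComplex) (L : AffineSubspace ℝ Plane)
    (hL : L ∈ X.spanLines) : ℝ :=
  (X.cellsOn L).sup' (cellsOn_nonempty hL) X.weight

theorem lineWeight_pos {X : WeightedComplex} {L : AffineSubspace ℝ Plane}
    (hL : L ∈ X.spanLines) : 0 < X.lineWeight L hL := by
  classical
  obtain ⟨P, hP⟩ := cellsOn_nonempty hL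
  rw [lineWeight, Finset.lt_sup'_iff]
  have h := Finset.mem_filter.mp (Finset.mem_filter.mp hP).1
  exact ⟨P, hP, X.weight_pos P h.1 h.2⟩

/-- The canonical arrangement of `X`: the sum of the affine spans of its maximal cells, each line
taken once. -/
noncomputable def canonicalArrangement (X : WeightedComplex) : Factorization where
  factors := X.spanLines.attach.val.map fun L =>
    lineComplex L.1 (finrank_of_mem_spanLines L.2) (X.lineWeight L.1 L.2) (lineWeight_pos L.2)
  balanced Y hY := by
    obtain ⟨L, -, rfl⟩ := Multiset.mem_map.mp hY
    exact lineComplex_isBalanced _ _ _ _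

end WeightedComplex

end PlaneComplex

/-!
Sweep the plane by parallel lines in a direction that is generic for a balanced complex `Z`.
Orienting the maximal cells along the sweep, consider the flows on them that satisfy Kirchhoff's
law at every vertex. For such a flow, the total flow through the cells below a point on its
sweeping line depends only on the region of the point, and crossing a cell changes it by the flow
along that cell. Hence the flows and the constants together embed into the functions on the set of
regions, which gives `cells - vertices + 1 ≤ mlen Z`.

If `Z` is balanced, a cell starts and a cell ends at every vertex, and the two cells at a vertex of
degree two lie on one line. The first cell on each line therefore does not start at a vertex of
degree two, so `lines + flat ≤ cells`, where `flat` is the number of such vertices. Counting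
incidences gives `3 * vertices ≤ 2 * cells + flat`, and together `lines + 3 ≤ 3 * mlen Z`.

Every line spanned by a cell of `X` contains infinitely many points of a cell of some factor of the
balancing, hence is a line of that factor, and the estimates for the factors add up.
-/

namespace PlaneComplex

open Filter Topology

theorem isExposed_singleton_of_injOn {E : Type*} [AddCommGroup E] [Module ℝ E]
    [TopologicalSpace E] {P : Set E} {l : E →L[ℝ] ℝ} (hl : Set.InjOn l P) {p : E} (hp : p ∈ P)
    (hmax : IsMaxOn l P p) : IsExposed ℝ P {p} := by
  refine fun _ => ⟨l, Set.ext fun x => ⟨?_, fun hx => ?_⟩⟩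
  · rintro rfl
    exact ⟨hp, hmax⟩
  · exact hl hx.1 hp ((hmax hx.1).antisymm (hx.2 p hp))

theorem eq_of_isExposed_of_nontrivial {E : Type*} [AddCommGroup E] [Module ℝ E]
    [TopologicalSpace E] {P F : Set E} (hP : Collinear ℝ P) (hF : IsExposed ℝ P F)
    (hF' : F.Nontrivial) : F = P := by
  obtain ⟨l, rfl⟩ := hF hF'.nonempty
  obtain ⟨x, hx, y, hy, hxy⟩ := hF'
  have hlxy : l x = l y := (hy.2 x hx.1).antisymm (hx.2 y hy.1)
  have hlx : ∀ z ∈ P, l z = l x := by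
    intro z hz
    obtain ⟨r, rfl⟩ := mem_affineSpan_pair_iff_exists_lineMap_eq.mp
      (hP.mem_affineSpan_of_mem_of_ne hx.1 hy.1 hz hxy)
    simp [AffineMap.lineMap_apply, hlxy]
  exact Set.ext fun z => ⟨fun hz => hz.1, fun hz => ⟨hz, fun w hw => by rw [hlx z hz, hlx w hw]⟩⟩

theorem affineSpan_eq_of_nontrivial_inter {k V E : Type*} [DivisionRing k] [AddCommGroup V]
    [Module k V] [AddTorsor V E] {P Q : Set E} (hP : Collinear k P) (hQ : Collinear k Q)
    (h : (P ∩ Q).Nontrivial) : affineSpan k P = affineSpan k Q := by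
  obtain ⟨x, hx, y, hy, hxy⟩ := h
  rw [← hP.affineSpan_eq_of_ne hx.1 hy.1 hxy, hQ.affineSpan_eq_of_ne hx.2 hy.2 hxy]

theorem affineSpan_eq_mk'_span_singleton {k V E : Type*} [DivisionRing k] [AddCommGroup V]
    [Module k V] [AddTorsor V E] {P : Set E} (hP : Collinear k P) {p : E} (hp : p ∈ P) {t : k}
    (ht : t ≠ 0) {u : V} (hu : u ≠ 0) (hpu : t • u +ᵥ p ∈ P) :
    affineSpan k P = AffineSubspace.mk' p (k ∙ u) := by
  have hne : p ≠ t • u +ᵥ p := fun h => smul_ne_zero ht hu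
    (by rw [← vadd_vsub (t • u) p, ← h, vsub_self])
  rw [← hP.affineSpan_eq_of_ne hp hpu hne, ← AffineSubspace.mk'_eq (left_mem_affineSpan_pair k p _),
    direction_affineSpan, vectorSpan_pair_rev, vadd_vsub,
    Submodule.span_singleton_smul_eq (IsUnit.mk0 t ht)]

theorem component_eq_of_segment_subset {E : Type*} [AddCommGroup E] [Module ℝ E]
    [TopologicalSpace E] [ContinuousAdd E] [ContinuousSMul ℝ E] {S : Set E} {x y : S}
    (h : segment ℝ (x : E) y ⊆ S) : (x : ConnectedComponents S) = y := by
  rw [ConnectedComponents.coe_eq_coe']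
  exact pathComponent_subset_component y
    ((joinedIn_iff_joined x.2 y.2).mp (JoinedIn.of_segment_subset h)).symm

theorem exists_injective_connectedComponents_set {E ι : Type*} [AddCommGroup E] [Module ℝ E]
    [TopologicalSpace E] [ContinuousAdd E] [ContinuousSMul ℝ E] {S : Set E}
    (g : ι → E →ᵃ[ℝ] ℝ) (hS : ∀ x, (∀ i, g i x ≠ 0) → x ∈ S)
    (hrep : ∀ x : S, ∃ y : S, (y : ConnectedComponents S) = x ∧ ∀ i, g i y ≠ 0) :
    ∃ f : ConnectedComponents S → Set ι, Function.Injective f := by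
  have hrep' : ∀ C : ConnectedComponents S, ∃ y : S, (y : ConnectedComponents S) = C ∧
      ∀ i, g i y ≠ 0 := fun C => by
    obtain ⟨x, rfl⟩ := ConnectedComponents.surjective_coe C
    exact hrep x
  choose y hy hne using hrep'
  refine ⟨fun C => {i | 0 < g i (y C)}, fun C D hCD => ?_⟩
  rw [← hy C, ← hy D]
  refine component_eq_of_segment_subset fun z hz => hS z fun i => ?_
  rcases (hne C i).lt_or_gt with hC | hC
  · have hD : g i (y D) < 0 :=
      (hne D i).lt_of_le (not_lt.mp fun h => hC.not_gt ((Set.ext_iff.mp hCD i).mpr h))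
    exact (((convex_Iio 0).affine_preimage (g i)).segment_subset hC hD hz).ne
  · exact (((convex_Ioi 0).affine_preimage (g i)).segment_subset hC
      ((Set.ext_iff.mp hCD i).mp hC) hz).ne'

theorem IsPolyhedron.eq_biInter {P : Set Plane} (hP : IsPolyhedron P) :
    ∃ H : Finset (Plane × ℝ), P = ⋂ h ∈ H, {x | inner ℝ h.1 x ≤ h.2} := by
  obtain ⟨H, rfl⟩ := hP
  exact ⟨H, by ext; simp⟩

theorem IsPolyhedron.isClosed {P : Set Plane} (hP : IsPolyhedron P) : IsClosed P := by
  obtain ⟨H, rfl⟩ := hP.eq_biInter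
  exact isClosed_biInter fun h _ => isClosed_le (by fun_prop) continuous_const

theorem IsPolyhedron.convex {P : Set Plane} (hP : IsPolyhedron P) : Convex ℝ P := by
  obtain ⟨H, rfl⟩ := hP.eq_biInter
  exact convex_iInter₂ fun h _ => convex_halfSpace_le (innerSL ℝ h.1).toLinearMap.isLinear _

theorem nontrivial_of_dim_eq_one {P : Set Plane} (hP : dim P = 1) : P.Nontrivial := by
  rw [← Set.not_subsingleton_iff]
  intro h
  rw [dim, vectorSpan_of_subsingleton ℝ h, finrank_bot] at hP
  exact zero_ne_one hP

theorem collinear_of_dim_eq_one {P : Set Plane} (hP : dim P = 1) : Collinear ℝ P :=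
  collinear_iff_finrank_le_one.mpr hP.le

namespace WeightedComplex

variable {X : WeightedComplex}

theorem mem_maxCells {P : Set Plane} : P ∈ X.maxCells ↔ P ∈ X.cells ∧ dim P = 1 := by
  classical
  exact Finset.mem_filter

theorem mem_cells (P : X.maxCells) : (P : Set Plane) ∈ X.cells := (mem_maxCells.mp P.2).1

theorem dim_eq_one (P : X.maxCells) : dim (P : Set Plane) = 1 := (mem_maxCells.mp P.2).2

theorem weight_maxCell_pos (P : X.maxCells) : 0 < X.weight P :=
  X.weight_pos P (mem_cells P) (dim_eq_one P)

theorem isClosed_maxCell (P : X.maxCells) : IsClosed (P : Set Plane) :=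
  (X.isPolyhedron P (mem_cells P)).isClosed

theorem convex_maxCell (P : X.maxCells) : Convex ℝ (P : Set Plane) :=
  (X.isPolyhedron P (mem_cells P)).convex

theorem nontrivial_maxCell (P : X.maxCells) : (P : Set Plane).Nontrivial :=
  nontrivial_of_dim_eq_one (dim_eq_one P)

theorem collinear_maxCell (P : X.maxCells) : Collinear ℝ (P : Set Plane) :=
  collinear_of_dim_eq_one (dim_eq_one P)

theorem infinite_maxCell (P : X.maxCells) : (P : Set Plane).Infinite :=
  (convex_maxCell P).isPreconnected.infinite_of_nontrivial (nontrivial_maxCell P)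

theorem subsingleton_inter_of_ne {P Q : X.maxCells} (hPQ : P ≠ Q) :
    ((P : Set Plane) ∩ Q).Subsingleton := by
  by_contra h
  rw [Set.not_subsingleton_iff] at h
  obtain ⟨hP, hQ⟩ := X.inter_face P (mem_cells P) Q (mem_cells Q) h.nonempty
  exact hPQ (Subtype.ext ((eq_of_isExposed_of_nontrivial (collinear_maxCell P) hP h).symm.trans
    (eq_of_isExposed_of_nontrivial (collinear_maxCell Q) hQ h)))

theorem mem_support {x : Plane} : x ∈ X.support ↔ ∃ P : X.maxCells, x ∈ (P : Set Plane) := by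
  simp [support]

theorem isClosed_support (X : WeightedComplex) : IsClosed X.support :=
  X.maxCells.finite_toSet.isClosed_biUnion fun P hP => isClosed_maxCell ⟨P, hP⟩

/-- The vertices of a complex: the points `p` such that `{p}` is a cell. -/
noncomputable def verts (X : WeightedComplex) : Finset Plane :=
  X.cells.preimage (fun p => {p}) Set.singleton_injective.injOn

theorem mem_verts {p : Plane} : p ∈ X.verts ↔ {p} ∈ X.cells :=
  Finset.mem_preimage

theorem mem_extremePoints_of_mem_verts {P : X.maxCells} {p : Plane} (hp : p ∈ X.verts)
    (hpP : p ∈ (P : Set Plane)) : p ∈ (P : Set Plane).extremePoints ℝ := by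
  have hinter : (P : Set Plane) ∩ {p} = {p} := Set.inter_singleton_of_mem hpP
  have hexposed := (X.inter_face P (mem_cells P) {p} (mem_verts.mp hp)
    (by rw [hinter]; exact Set.singleton_nonempty p)).1
  rw [hinter] at hexposed
  exact hexposed.isExtreme.mem_extremePoints

end WeightedComplex

theorem exists_dual_ker_eq_span_singleton {k V : Type*} [Field k] [AddCommGroup V] [Module k V]
    (hV : Module.finrank k V = 2) {v : V} (hv : v ≠ 0) :
    ∃ l : Module.Dual k V, LinearMap.ker l = k ∙ v := by
  have : Module.Finite k V := Module.finite_of_finrank_pos (by omega)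
  have hquot : Module.finrank k (V ⧸ k ∙ v) = Module.finrank k k := by
    have := Submodule.finrank_quotient_add_finrank (k ∙ v)
    rw [finrank_span_singleton hv] at this
    rw [Module.finrank_self]
    omega
  refine ⟨(LinearEquiv.ofFinrankEq _ _ hquot).toLinearMap ∘ₗ (k ∙ v).mkQ, ?_⟩
  rw [LinearEquiv.ker_comp, Submodule.ker_mkQ]

namespace WeightedComplex

variable {X : WeightedComplex}

theorem exists_notMem_vectorSpan (X : WeightedComplex) :
    ∃ v : Plane, v ≠ 0 ∧ ∀ P : X.maxCells, v ∉ vectorSpan ℝ (P : Set Plane) := by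
  classical
  let s : Finset (Submodule ℝ Plane) := insert ⊥ (X.maxCells.image (vectorSpan ℝ))
  have htop : ⊤ ∉ s := by
    have hfinrank := finrank_euclideanSpace_fin (𝕜 := ℝ) (n := 2)
    simp only [s, Finset.mem_insert, Finset.mem_image, not_or, not_exists, not_and]
    refine ⟨fun h => ?_, fun P hP h => ?_⟩
    · rw [← finrank_top ℝ, h, finrank_bot] at hfinrank
      omega
    · have hdim := (mem_maxCells.mp hP).2
      rw [dim, h, finrank_top, hfinrank] at hdim
      omega
  obtain ⟨v, hv⟩ := (Set.ne_univ_iff_exists_notMem _).mp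
    (Subspace.biUnion_ne_univ_of_top_notMem htop)
  simp only [Set.mem_iUnion, not_exists] at hv
  exact ⟨v, fun h => hv ⊥ (Finset.mem_insert_self _ _) (by simp [h]), fun P =>
    hv _ (Finset.mem_insert_of_mem (Finset.mem_image_of_mem _ P.2))⟩

/-- A generic direction in which the complex `X` is swept by parallel lines: the sweeping lines
are the level sets of the linear functional `absc`, they have direction `up` and they are not
parallel to any maximal cell. The affine function `height P` measures, in multiples of `up`, how
high a point lies above the line that carries the maximal cell `P`. -/
structure Sweep (X : WeightedComplex) where
  absc : Plane →L[ℝ] ℝ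
  up : Plane
  ker_absc : absc.ker = ℝ ∙ up
  height : X.maxCells → Plane →ᴬ[ℝ] ℝ
  contLinear_height_up : ∀ P, (height P).contLinear up = 1
  height_of_mem : ∀ P : X.maxCells, ∀ x ∈ (P : Set Plane), height P x = 0

theorem exists_height (P : X.maxCells) {v : Plane} (hv : v ∉ vectorSpan ℝ (P : Set Plane)) :
    ∃ f : Plane →ᴬ[ℝ] ℝ, f.contLinear v = 1 ∧ ∀ x ∈ (P : Set Plane), f x = 0 := by
  obtain ⟨l, hlv, hl⟩ := Submodule.exists_le_ker_of_notMem hv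
  obtain ⟨p, hp⟩ := (nontrivial_maxCell P).nonempty
  refine ⟨((l v)⁻¹ • l.toContinuousLinearMap).toContinuousAffineMap -
    ContinuousAffineMap.const ℝ Plane ((l v)⁻¹ * l p), ?_, fun x hx => ?_⟩
  · simp [hlv]
  · have hlx : l (x - p) = 0 := hl (vsub_mem_vectorSpan ℝ hx hp)
    rw [map_sub, sub_eq_zero] at hlx
    simp [hlx]

theorem nonempty_sweep (X : WeightedComplex) : Nonempty X.Sweep := by
  obtain ⟨up, hup, hspan⟩ := X.exists_notMem_vectorSpan
  obtain ⟨l, hl⟩ := exists_dual_ker_eq_span_singleton (finrank_euclideanSpace_fin (𝕜 := ℝ)) hup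
  choose height hheight_up hheight using fun P => exists_height P (hspan P)
  exact ⟨⟨l.toContinuousLinearMap, up, hl, height, hheight_up, hheight⟩⟩

namespace Sweep

variable (S : X.Sweep)

/-- The same sweep, run in the opposite direction. -/
def reverse : X.Sweep where
  absc := -S.absc
  up := S.up
  ker_absc := by rw [← S.ker_absc]; ext; simp
  height := S.height
  contLinear_height_up := S.contLinear_height_up
  height_of_mem := S.height_of_mem

theorem absc_up : S.absc S.up = 0 := by
  have : S.up ∈ S.absc.ker := S.ker_absc ▸ Submodule.mem_span_singleton_self S.up
  exact this

theorem absc_add_smul_up (x : Plane) (t : ℝ) : S.absc (x + t • S.up) = S.absc x := by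
  rw [map_add, map_smul, absc_up, smul_zero, add_zero]

theorem height_add_smul_up (P : X.maxCells) (x : Plane) (t : ℝ) :
    S.height P (x + t • S.up) = S.height P x + t := by
  rw [add_comm x, ← vadd_eq_add, ContinuousAffineMap.map_vadd, map_smul, S.contLinear_height_up,
    smul_eq_mul, mul_one, vadd_eq_add, add_comm]

theorem exists_eq_add_smul_up {x y : Plane} (h : S.absc x = S.absc y) :
    ∃ t : ℝ, x = y + t • S.up := by
  have hker : x - y ∈ S.absc.ker := by simp [h]
  rw [S.ker_absc] at hker
  obtain ⟨t, ht⟩ := Submodule.mem_span_singleton.mp hker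
  exact ⟨t, by rw [ht]; abel⟩

/-- The projection of `x`, along the sweeping line through `x`, to the line carrying `P`. -/
noncomputable def foot (P : X.maxCells) (x : Plane) : Plane := x - S.height P x • S.up

theorem absc_foot (P : X.maxCells) (x : Plane) : S.absc (S.foot P x) = S.absc x := by
  rw [foot, sub_eq_add_neg, ← neg_smul, absc_add_smul_up]

theorem continuous_foot (P : X.maxCells) : Continuous (S.foot P) := by
  have := (S.height P).continuous
  unfold foot
  fun_prop

theorem foot_eq_of_absc_eq {P : X.maxCells} {p x : Plane} (hp : p ∈ (P : Set Plane))
    (h : S.absc x = S.absc p) : S.foot P x = p := by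
  obtain ⟨t, rfl⟩ := S.exists_eq_add_smul_up h
  rw [foot, height_add_smul_up, S.height_of_mem P p hp, zero_add, add_sub_cancel_right]

theorem injOn_absc (P : X.maxCells) : Set.InjOn S.absc (P : Set Plane) := fun x hx y hy h => by
  rw [← S.foot_eq_of_absc_eq hx rfl, S.foot_eq_of_absc_eq hy h]

theorem foot_mem_of_absc_mem_Icc {P : X.maxCells} {p q x : Plane} (hp : p ∈ (P : Set Plane))
    (hq : q ∈ (P : Set Plane)) (hx : S.absc x ∈ Set.Icc (S.absc p) (S.absc q)) :
    S.foot P x ∈ (P : Set Plane) := by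
  have hord : (S.absc '' (P : Set Plane)).OrdConnected :=
    ((convex_maxCell P).linear_image S.absc.toLinearMap).ordConnected
  obtain ⟨z, hz, hzx⟩ := hord.out (Set.mem_image_of_mem _ hp) (Set.mem_image_of_mem _ hq) hx
  rwa [S.foot_eq_of_absc_eq hz hzx.symm]

/-- The cell `P` ends at `p`: its furthest point in the direction of the sweep is `p`. -/
def EndsAt (P : Set Plane) (p : Plane) : Prop := p ∈ P ∧ IsMaxOn S.absc P p

/-- The cell `P` starts at `p`: its first point in the direction of the sweep is `p`. -/
def StartsAt (P : Set Plane) (p : Plane) : Prop := p ∈ P ∧ IsMinOn S.absc P p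

theorem reverse_endsAt {P : Set Plane} {p : Plane} :
    S.reverse.EndsAt P p ↔ S.StartsAt P p := by
  simp [EndsAt, StartsAt, reverse, isMaxOn_iff, isMinOn_iff]

theorem reverse_startsAt {P : Set Plane} {p : Plane} :
    S.reverse.StartsAt P p ↔ S.EndsAt P p := by
  simp [EndsAt, StartsAt, reverse, isMaxOn_iff, isMinOn_iff]

variable {S} {P : X.maxCells} {p q : Plane}

theorem EndsAt.mem_verts (h : S.EndsAt P p) : p ∈ X.verts :=
  WeightedComplex.mem_verts.mpr (X.face_mem P (mem_cells P) {p} (Set.singleton_nonempty p)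
    (isExposed_singleton_of_injOn (S.injOn_absc P) h.1 h.2))

theorem StartsAt.mem_verts (h : S.StartsAt P p) : p ∈ X.verts :=
  (S.reverse_endsAt.mpr h).mem_verts

theorem EndsAt.eq (hp : S.EndsAt P p) (hq : S.EndsAt P q) : p = q :=
  S.injOn_absc P hp.1 hq.1 ((hq.2 hp.1).antisymm (hp.2 hq.1))

theorem StartsAt.eq (hp : S.StartsAt P p) (hq : S.StartsAt P q) : p = q :=
  (S.reverse_endsAt.mpr hp).eq (S.reverse_endsAt.mpr hq)

theorem StartsAt.not_endsAt (hp : S.StartsAt P p) : ¬S.EndsAt P p := by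
  intro hq
  obtain ⟨x, hx, y, hy, hxy⟩ := nontrivial_maxCell P
  have habsc : ∀ z ∈ (P : Set Plane), S.absc z = S.absc p := fun z hz =>
    (hq.2 hz).antisymm (hp.2 hz)
  exact hxy (S.injOn_absc P hx hy ((habsc x hx).trans (habsc y hy).symm))

variable (S) in
theorem startsAt_or_endsAt (hp : p ∈ X.verts) (hpP : p ∈ (P : Set Plane)) :
    S.StartsAt P p ∨ S.EndsAt P p := by
  by_contra! h
  simp only [StartsAt, EndsAt, hpP, true_and, isMinOn_iff, isMaxOn_iff, not_forall, not_le] at h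
  obtain ⟨⟨x, hx, hxp⟩, ⟨y, hy, hpy⟩⟩ := h
  have hext := mem_extremePoints_of_mem_verts hp hpP
  have hopen : S.absc p ∈ S.absc '' openSegment ℝ x y := by
    rw [← ContinuousLinearMap.coe_coe, ← LinearMap.coe_toAffineMap, image_openSegment]
    exact openSegment_eq_Ioo (hxp.trans hpy) ▸ ⟨hxp, hpy⟩
  obtain ⟨z, hz, hzp⟩ := hopen
  have hzP := (convex_maxCell P).openSegment_subset hx hy hz
  rw [S.injOn_absc P hzP hpP hzp] at hz
  exact hxp.ne (congrArg S.absc (hext.2 hx hy hz))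

end Sweep
end WeightedComplex

namespace WeightedComplex.Sweep

variable {X : WeightedComplex} (S : X.Sweep)

open Classical in
/-- The maximal cells that lie below the point `x` on the sweeping line through `x`. -/
noncomputable def cellsBelow (x : Plane) : Finset X.maxCells :=
  {P | S.foot P x ∈ (P : Set Plane) ∧ 0 < S.height P x}

theorem mem_cellsBelow {x : Plane} {P : X.maxCells} :
    P ∈ S.cellsBelow x ↔ S.foot P x ∈ (P : Set Plane) ∧ 0 < S.height P x := by
  simp [cellsBelow]

open Classical in
/-- The maximal cells below `x` that do not end on the sweeping line through `x`. Equivalently,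
the cells below the points slightly ahead of `x`. -/
noncomputable def cellsBelowAhead (x : Plane) : Finset X.maxCells :=
  {P ∈ S.cellsBelow x | ∃ q ∈ (P : Set Plane), S.absc x < S.absc q}

theorem mem_cellsBelowAhead {x : Plane} {P : X.maxCells} :
    P ∈ S.cellsBelowAhead x ↔
      P ∈ S.cellsBelow x ∧ ∃ q ∈ (P : Set Plane), S.absc x < S.absc q := by
  simp [cellsBelowAhead]

theorem eventually_mem_cellsBelowAhead_iff {P : X.maxCells} {x₀ : Plane}
    (hx₀ : x₀ ∉ (P : Set Plane)) :
    ∀ᶠ x in 𝓝 x₀, S.absc x₀ ≤ S.absc x →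
      (P ∈ S.cellsBelowAhead x ↔ P ∈ S.cellsBelowAhead x₀) := by
  have hheight := (S.height P).continuous
  by_cases hfoot : S.foot P x₀ ∈ (P : Set Plane)
  · have hne : S.height P x₀ ≠ 0 := fun h => hx₀ (by simpa [foot, h] using hfoot)
    rcases hne.lt_or_gt with hlt | hgt
    · filter_upwards [hheight.continuousAt.eventually_lt_const hlt] with x hx _
      simp only [mem_cellsBelowAhead, mem_cellsBelow, hx.not_gt, hlt.not_gt, and_false, false_and]
    by_cases hahead : ∃ q ∈ (P : Set Plane), S.absc x₀ < S.absc q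
    · obtain ⟨q, hq, hxq⟩ := hahead
      filter_upwards [hheight.continuousAt.eventually_const_lt hgt,
        S.absc.continuous.continuousAt.eventually_lt_const hxq] with x hx hlt hle
      have hfootx : S.foot P x ∈ (P : Set Plane) :=
        S.foot_mem_of_absc_mem_Icc hfoot hq ⟨(S.absc_foot P x₀).trans_le hle, hlt.le⟩
      exact iff_of_true (S.mem_cellsBelowAhead.mpr ⟨S.mem_cellsBelow.mpr ⟨hfootx, hx⟩, q, hq, hlt⟩)
        (S.mem_cellsBelowAhead.mpr ⟨S.mem_cellsBelow.mpr ⟨hfoot, hgt⟩, q, hq, hxq⟩)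
    · refine .of_forall fun x hle => iff_of_false (fun h => hahead ?_) fun h => hahead ?_
      · obtain ⟨-, q, hq, hxq⟩ := S.mem_cellsBelowAhead.mp h
        exact ⟨q, hq, hle.trans_lt hxq⟩
      · exact (S.mem_cellsBelowAhead.mp h).2
  · filter_upwards [(S.continuous_foot P).continuousAt.eventually_mem
      ((isClosed_maxCell P).isOpen_compl.mem_nhds hfoot)] with x hx _
    simp only [mem_cellsBelowAhead, mem_cellsBelow, hfoot, Set.notMem_of_mem_compl hx, false_and]

/-- The total flow, slightly ahead of `x`, carried by the maximal cells below `x`, as a linear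
function of the flows `c : X.maxCells → ℝ` along the maximal cells. -/
noncomputable def flowBelow (x : Plane) : (X.maxCells → ℝ) →ₗ[ℝ] ℝ :=
  ∑ P ∈ S.cellsBelowAhead x, LinearMap.proj P

theorem eventually_flowBelow_eq {x₀ : Plane} (hx₀ : x₀ ∉ X.support) :
    ∀ᶠ x in 𝓝 x₀, S.absc x₀ ≤ S.absc x → S.flowBelow x = S.flowBelow x₀ := by
  have hmem := eventually_all.mpr fun P : X.maxCells =>
    S.eventually_mem_cellsBelowAhead_iff fun hP => hx₀ (mem_support.mpr ⟨P, hP⟩)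
  filter_upwards [hmem] with x hx hle
  rw [flowBelow, flowBelow, Finset.ext fun P => hx P hle]

open Classical in
/-- The maximal cells that end at `p`. -/
noncomputable def cellsInto (p : Plane) : Finset X.maxCells := {P | S.EndsAt P p}

/-- The total flow carried by the maximal cells that end at `p`. -/
noncomputable def flowInto (p : Plane) : (X.maxCells → ℝ) →ₗ[ℝ] ℝ :=
  ∑ P ∈ S.cellsInto p, LinearMap.proj P

open Classical in
/-- The vertices below the point `x` on the sweeping line through `x`. -/
noncomputable def vertsBelow (x : Plane) : Finset Plane :=
  {p ∈ X.verts | ∃ t : ℝ, 0 < t ∧ x = p + t • S.up}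

theorem mem_vertsBelow {x p : Plane} :
    p ∈ S.vertsBelow x ↔ p ∈ X.verts ∧ ∃ t : ℝ, 0 < t ∧ x = p + t • S.up := by
  simp [vertsBelow]

theorem mem_cellsBelow_not_ahead_iff {x : Plane} {P : X.maxCells} :
    (P ∈ S.cellsBelow x ∧ ¬∃ q ∈ (P : Set Plane), S.absc x < S.absc q) ↔
      ∃ p ∈ S.vertsBelow x, S.EndsAt P p := by
  simp only [mem_vertsBelow, mem_cellsBelow, not_exists, not_and, not_lt]
  constructor
  · rintro ⟨⟨hfoot, hheight⟩, hmax⟩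
    have hends : S.EndsAt P (S.foot P x) := ⟨hfoot, fun q hq => (hmax q hq).trans_eq
      (S.absc_foot P x).symm⟩
    exact ⟨_, ⟨hends.mem_verts, S.height P x, hheight, by rw [foot, sub_add_cancel]⟩, hends⟩
  · rintro ⟨p, ⟨-, t, ht, rfl⟩, hends⟩
    rw [S.foot_eq_of_absc_eq hends.1 (S.absc_add_smul_up p t), height_add_smul_up,
      S.height_of_mem P p hends.1, zero_add, absc_add_smul_up]
    exact ⟨⟨hends.1, ht⟩, fun q hq => hends.2 hq⟩

theorem flowBelow_add_sum_flowInto (x : Plane) :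
    S.flowBelow x + ∑ p ∈ S.vertsBelow x, S.flowInto p =
      ∑ P ∈ S.cellsBelow x, LinearMap.proj P := by
  classical
  rw [flowBelow, cellsBelowAhead, ← Finset.sum_filter_add_sum_filter_not (S.cellsBelow x)
    fun P => ∃ q ∈ (P : Set Plane), S.absc x < S.absc q]
  simp only [flowInto, cellsInto]
  rw [← Finset.sum_biUnion]
  · congr 2
    ext P
    simp only [Finset.mem_biUnion, Finset.mem_filter, Finset.mem_univ, true_and,
      S.mem_cellsBelow_not_ahead_iff]
  · intro p _ q _ hpq
    exact Finset.disjoint_filter.mpr fun P _ hp hq => hpq (hp.eq hq)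

/-- The net flow into each of the vertices. Its kernel consists of the flows that satisfy
Kirchhoff's law. -/
noncomputable def netFlow : (X.maxCells → ℝ) →ₗ[ℝ] X.verts → ℝ :=
  LinearMap.pi fun p => S.flowInto p - S.reverse.flowInto p

theorem reverse_flowBelow_eq {c : X.maxCells → ℝ} (hc : S.netFlow c = 0) (x : Plane) :
    S.reverse.flowBelow x c = S.flowBelow x c := by
  have hinto : ∀ p ∈ S.vertsBelow x, S.flowInto p c = S.reverse.flowInto p c := fun p hp =>
    sub_eq_zero.mp (congrFun hc ⟨p, (S.mem_vertsBelow.mp hp).1⟩)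
  have hforward := LinearMap.congr_fun (S.flowBelow_add_sum_flowInto x) c
  have hbackward := LinearMap.congr_fun (S.reverse.flowBelow_add_sum_flowInto x) c
  -- The sets `cellsBelow` and `vertsBelow` do not change when the sweep is reversed.
  change _ = (∑ P ∈ S.cellsBelow x, LinearMap.proj P : (X.maxCells → ℝ) →ₗ[ℝ] ℝ) c at hbackward
  rw [← hforward, LinearMap.add_apply, LinearMap.add_apply, LinearMap.sum_apply,
    LinearMap.sum_apply, Finset.sum_congr rfl hinto] at hbackward
  exact add_right_cancel hbackward

theorem flowBelow_eq_of_component_eq {c : X.maxCells → ℝ} (hc : S.netFlow c = 0)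
    {x y : ↥X.supportᶜ} (h : (x : ConnectedComponents ↥X.supportᶜ) = y) :
    S.flowBelow x c = S.flowBelow y c := by
  have hlocal : IsLocallyConstant fun z : ↥X.supportᶜ => S.flowBelow z c := by
    refine (IsLocallyConstant.iff_eventually_eq _).mpr fun z => ?_
    filter_upwards [continuous_subtype_val.continuousAt.eventually (S.eventually_flowBelow_eq z.2),
      continuous_subtype_val.continuousAt.eventually (S.reverse.eventually_flowBelow_eq z.2)]
      with w hforward hbackward
    rcases le_total (S.absc z) (S.absc w) with hle | hle
    · rw [hforward hle]
    · rw [← S.reverse_flowBelow_eq hc, ← S.reverse_flowBelow_eq hc,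
        hbackward (neg_le_neg hle)]
  exact hlocal.apply_eq_of_isPreconnected isPreconnected_connectedComponent
    mem_connectedComponent (ConnectedComponents.coe_eq_coe'.mp h.symm)

theorem exists_mem_not_endsAt (P : X.maxCells) :
    ∃ p ∈ (P : Set Plane), ¬S.EndsAt P p ∧ ∀ Q : X.maxCells, Q ≠ P → p ∉ (Q : Set Plane) := by
  have hends : {p | S.EndsAt P p}.Finite :=
    Set.Subsingleton.finite fun p hp q hq => EndsAt.eq hp hq
  have hinter : (⋃ Q : {Q : X.maxCells // Q ≠ P}, (P : Set Plane) ∩ Q).Finite :=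
    Set.finite_iUnion fun Q => (subsingleton_inter_of_ne Q.2.symm).finite
  obtain ⟨p, hp, hnot⟩ := ((infinite_maxCell P).sdiff (hends.union hinter)).nonempty
  simp only [Set.mem_union, Set.mem_iUnion, not_or, not_exists] at hnot
  exact ⟨p, hp, hnot.1, fun Q hQ hpQ => hnot.2 ⟨Q, hQ⟩ ⟨hp, hpQ⟩⟩

theorem cellsBelowAhead_add_smul_up [DecidableEq X.maxCells] {P : X.maxCells} {p : Plane}
    {t : ℝ} (ht : 0 < t) (hp : p ∈ (P : Set Plane)) (hend : ¬S.EndsAt P p)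
    (hne : ∀ Q ≠ P, Q ∈ S.cellsBelowAhead (p + t • S.up) ↔
      Q ∈ S.cellsBelowAhead (p + (-t) • S.up)) :
    S.cellsBelowAhead (p + t • S.up) = insert P (S.cellsBelowAhead (p + (-t) • S.up)) := by
  ext Q
  rcases eq_or_ne Q P with rfl | hQ
  · simp only [Finset.mem_insert_self, iff_true, mem_cellsBelowAhead, mem_cellsBelow]
    simp only [EndsAt, hp, true_and, isMaxOn_iff, not_forall, not_le] at hend
    obtain ⟨q, hq, hpq⟩ := hend
    rw [S.foot_eq_of_absc_eq hp (S.absc_add_smul_up p t), height_add_smul_up,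
      S.height_of_mem Q p hp, zero_add, absc_add_smul_up]
    exact ⟨⟨hp, ht⟩, q, hq, hpq⟩
  · rw [hne Q hQ, Finset.mem_insert, or_iff_right hQ]

theorem exists_flowBelow_eq_add_proj (P : X.maxCells) :
    ∃ x y : ↥X.supportᶜ, S.flowBelow x = S.flowBelow y + LinearMap.proj P := by
  classical
  obtain ⟨p, hp, hend, hother⟩ := S.exists_mem_not_endsAt P
  have hnear : ∀ᶠ x in 𝓝 p, ∀ Q : X.maxCells, Q ≠ P → x ∉ (Q : Set Plane) ∧
      (S.absc p ≤ S.absc x → (Q ∈ S.cellsBelowAhead x ↔ Q ∈ S.cellsBelowAhead p)) :=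
    eventually_all.mpr fun Q => eventually_imp_distrib_left.mpr fun hQ =>
      ((isClosed_maxCell Q).isOpen_compl.eventually_mem (hother Q hQ)).and
        (S.eventually_mem_cellsBelowAhead_iff (hother Q hQ))
  have htendsto : Tendsto (fun t : ℝ => p + t • S.up) (𝓝 0) (𝓝 p) :=
    Continuous.tendsto' (by fun_prop) _ _ (by simp)
  obtain ⟨ε, hε, hball⟩ := Metric.eventually_nhds_iff.mp (htendsto.eventually hnear)
  have hpos : dist (ε / 2) 0 < ε := by simp [abs_of_pos hε, hε]
  have hneg : dist (-(ε / 2)) 0 < ε := by simp [abs_of_pos hε, hε]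
  have hsupport : ∀ t : ℝ, dist t 0 < ε → t ≠ 0 → p + t • S.up ∈ X.supportᶜ := by
    intro t ht htne hmem
    obtain ⟨Q, hQ⟩ := mem_support.mp hmem
    rcases eq_or_ne Q P with rfl | hQP
    · have := S.height_of_mem Q _ hQ
      rw [height_add_smul_up, S.height_of_mem Q p hp, zero_add] at this
      exact htne this
    · exact (hball ht Q hQP).1 hQ
  refine ⟨⟨_, hsupport _ hpos (by positivity)⟩, ⟨_, hsupport _ hneg (by linarith)⟩, ?_⟩
  have hcells := S.cellsBelowAhead_add_smul_up (half_pos hε) hp hend fun Q hQ =>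
    ((hball hpos Q hQ).2 (S.absc_add_smul_up _ _).ge).trans
      ((hball hneg Q hQ).2 (S.absc_add_smul_up _ _).ge).symm
  have hnotMem : P ∉ S.cellsBelowAhead (p + (-(ε / 2)) • S.up) := by
    rw [mem_cellsBelowAhead, mem_cellsBelow, height_add_smul_up, S.height_of_mem P p hp]
    exact fun h => by linarith [h.1.2]
  rw [flowBelow, hcells, Finset.sum_insert hnotMem, add_comm, flowBelow]

theorem eq_zero_of_flowBelow_eq {c : X.maxCells → ℝ}
    (hc : ∀ x y : ↥X.supportᶜ, S.flowBelow x c = S.flowBelow y c) : c = 0 := by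
  funext P
  obtain ⟨x, y, hxy⟩ := S.exists_flowBelow_eq_add_proj P
  have := hc x y
  rwa [hxy, LinearMap.add_apply, LinearMap.proj_apply, add_eq_left] at this

theorem exists_height_ne_zero {x : Plane} {U : Set Plane} (hU : U ∈ 𝓝 x) :
    ∃ y ∈ U, ∀ P, S.height P y ≠ 0 := by
  have hnhds : {t : ℝ | x + t • S.up ∈ U} ∈ 𝓝 0 :=
    (Continuous.tendsto' (by fun_prop) _ _ (by simp)).eventually_mem hU
  obtain ⟨t, ht, hheight⟩ := ((infinite_of_mem_nhds 0 hnhds).sdiff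
    (Set.finite_range fun P => -S.height P x)).nonempty
  refine ⟨_, ht, fun P h => hheight ⟨P, ?_⟩⟩
  rw [height_add_smul_up] at h
  exact neg_eq_of_add_eq_zero_right h

theorem mem_compl_support_of_height_ne_zero {x : Plane} (hx : ∀ P, S.height P x ≠ 0) :
    x ∈ X.supportᶜ := fun h => by
  obtain ⟨P, hP⟩ := mem_support.mp h
  exact hx P (S.height_of_mem P x hP)

theorem exists_component_eq_and_height_ne_zero (x : ↥X.supportᶜ) :
    ∃ y : ↥X.supportᶜ, (y : ConnectedComponents ↥X.supportᶜ) = x ∧ ∀ P, S.height P y ≠ 0 := by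
  obtain ⟨ε, hε, hball⟩ := Metric.isOpen_iff.mp X.isClosed_support.isOpen_compl x x.2
  obtain ⟨y, hy, hne⟩ := S.exists_height_ne_zero (Metric.ball_mem_nhds (x : Plane) hε)
  refine ⟨⟨y, hball hy⟩, component_eq_of_segment_subset ?_, hne⟩
  exact ((convex_ball _ _).segment_subset hy (Metric.mem_ball_self hε)).trans hball

end WeightedComplex.Sweep

namespace WeightedComplex

theorem nonempty_compl_support (X : WeightedComplex) : (X.supportᶜ).Nonempty := by
  obtain ⟨S⟩ := X.nonempty_sweep
  obtain ⟨x, -, hx⟩ := S.exists_height_ne_zero (univ_mem (f := 𝓝 0))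
  exact ⟨x, S.mem_compl_support_of_height_ne_zero hx⟩

theorem exists_injective_regions_set (X : WeightedComplex) :
    ∃ f : ConnectedComponents ↥X.supportᶜ → Set X.maxCells, Function.Injective f := by
  obtain ⟨S⟩ := X.nonempty_sweep
  exact exists_injective_connectedComponents_set (fun P => (S.height P : Plane →ᵃ[ℝ] ℝ))
    (fun x => S.mem_compl_support_of_height_ne_zero) S.exists_component_eq_and_height_ne_zero

theorem mlen_le_two_pow (X : WeightedComplex) : X.mlen ≤ 2 ^ X.maxCells.card := by
  obtain ⟨f, hf⟩ := X.exists_injective_regions_set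
  simpa [mlen] using Nat.card_le_card_of_injective f hf

namespace Sweep

variable {X : WeightedComplex} (S : X.Sweep)

/-- The flow below each region of the complement of the support, for the flows that satisfy
Kirchhoff's law. It does not depend on the point that represents the region. -/
noncomputable def regionFlow :
    LinearMap.ker S.netFlow →ₗ[ℝ] ConnectedComponents ↥X.supportᶜ → ℝ :=
  LinearMap.pi fun C => S.flowBelow (ConnectedComponents.surjective_coe C).choose ∘ₗ
    (LinearMap.ker S.netFlow).subtype

theorem regionFlow_apply (c : LinearMap.ker S.netFlow) (x : ↥X.supportᶜ) :
    S.regionFlow c (x : ConnectedComponents ↥X.supportᶜ) = S.flowBelow x c :=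
  S.flowBelow_eq_of_component_eq c.2 (ConnectedComponents.surjective_coe _).choose_spec

theorem injective_regionFlow_coprod_const :
    Function.Injective (S.regionFlow.coprod (LinearMap.pi fun _ => LinearMap.id)) := by
  rw [injective_iff_map_eq_zero]
  rintro ⟨c, r⟩ h
  have hflow : ∀ x : ↥X.supportᶜ, S.flowBelow x c + r = 0 := fun x => by
    simpa [regionFlow_apply] using congrFun h (x : ConnectedComponents ↥X.supportᶜ)
  have hc : (c : X.maxCells → ℝ) = 0 := S.eq_zero_of_flowBelow_eq fun x y =>
    add_right_cancel ((hflow x).trans (hflow y).symm)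
  obtain ⟨x, hx⟩ := X.nonempty_compl_support
  have hr := hflow ⟨x, hx⟩
  rw [hc, map_zero, zero_add] at hr
  exact Prod.ext (Subtype.ext hc) hr

end Sweep

theorem card_maxCells_lt_mlen_add_card_verts (X : WeightedComplex) :
    X.maxCells.card < X.mlen + X.verts.card := by
  obtain ⟨S⟩ := X.nonempty_sweep
  obtain ⟨f, hf⟩ := X.exists_injective_regions_set
  have := Finite.of_injective f hf
  have := Fintype.ofFinite (ConnectedComponents ↥X.supportᶜ)
  have hregions := LinearMap.finrank_le_finrank_of_injective S.injective_regionFlow_coprod_const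
  have hkernel := S.netFlow.finrank_range_add_finrank_ker
  have hrange := Submodule.finrank_le (LinearMap.range S.netFlow)
  simp only [Module.finrank_prod, Module.finrank_self, Module.finrank_fintype_fun_eq_card,
    Fintype.card_coe] at hregions hkernel hrange
  rw [mlen, Nat.card_eq_fintype_card]
  omega

end WeightedComplex

namespace WeightedComplex

variable {X : WeightedComplex}

open Classical in
/-- The maximal cells that contain the point `p`. At a vertex their number is the degree. -/
noncomputable def cellsAt (X : WeightedComplex) (p : Plane) : Finset X.maxCells :=
  {P | p ∈ (P : Set Plane)}

theorem mem_cellsAt {p : Plane} {P : X.maxCells} : P ∈ X.cellsAt p ↔ p ∈ (P : Set Plane) := by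
  simp [cellsAt]

theorem nonempty_cellsAt {p : Plane} (hp : p ∈ X.verts) : (X.cellsAt p).Nonempty := by
  obtain ⟨P, hP, hpP, hdim⟩ := X.isPure _ (mem_verts.mp hp)
  exact ⟨⟨P, mem_maxCells.mpr ⟨hP, hdim⟩⟩, mem_cellsAt.mpr (hpP rfl)⟩

theorem IsBalanced.exists_directions (hX : X.IsBalanced) {p : Plane} (hp : p ∈ X.verts) :
    ∃ u : X.maxCells → Plane,
      (∀ P ∈ X.cellsAt p, u P ≠ 0 ∧ ∃ t : ℝ, 0 < t ∧ p + t • u P ∈ (P : Set Plane)) ∧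
      ∑ P ∈ X.cellsAt p, X.weight P • u P = 0 := by
  classical
  obtain ⟨u, hu, hsum⟩ := hX p (mem_verts.mp hp)
  refine ⟨fun P => u P, fun P hP => ?_, ?_⟩
  · obtain ⟨hnorm, hmem⟩ := hu P P.2 (mem_cellsAt.mp hP)
    exact ⟨ne_zero_of_norm_ne_zero (hnorm ▸ one_ne_zero), hmem⟩
  · rw [Finset.sum_filter] at hsum
    rw [cellsAt, Finset.sum_filter]
    exact (Finset.sum_coe_sort X.maxCells fun P => if p ∈ P then X.weight P • u P else 0).trans hsum

theorem IsBalanced.exists_startsAt (hX : X.IsBalanced) (S : X.Sweep) {p : Plane}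
    (hp : p ∈ X.verts) : ∃ P : X.maxCells, S.StartsAt P p := by
  obtain ⟨u, hu, hsum⟩ := hX.exists_directions hp
  have hne : ∀ P ∈ X.cellsAt p, X.weight P * S.absc (u P) ≠ 0 := fun P hP habsc => by
    obtain ⟨hu0, t, ht, hmem⟩ := hu P hP
    have huabsc := (mul_eq_zero_iff_left (weight_maxCell_pos P).ne').mp habsc
    have := S.injOn_absc P hmem (mem_cellsAt.mp hP) (by simp [huabsc])
    exact smul_ne_zero ht.ne' hu0 (add_eq_left.mp this)
  have hsum' : ∑ P ∈ X.cellsAt p, X.weight P * S.absc (u P) = 0 := by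
    simpa using congrArg S.absc hsum
  obtain ⟨P₀, hP₀⟩ := nonempty_cellsAt hp
  obtain ⟨P, hP, hpos⟩ :=
    Finset.exists_pos_of_sum_zero_of_exists_nonzero _ hsum' ⟨P₀, hP₀, hne P₀ hP₀⟩
  obtain ⟨-, t, ht, hmem⟩ := hu P hP
  refine ⟨P, (S.startsAt_or_endsAt hp (mem_cellsAt.mp hP)).resolve_right fun hend => ?_⟩
  have hle : S.absc (p + t • u P) ≤ S.absc p := hend.2 hmem
  rw [map_add, map_smul, smul_eq_mul, add_le_iff_nonpos_right] at hle
  exact hle.not_gt (mul_pos ht (pos_of_mul_pos_right hpos (weight_maxCell_pos P).le))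

theorem IsBalanced.exists_endsAt (hX : X.IsBalanced) (S : X.Sweep) {p : Plane}
    (hp : p ∈ X.verts) : ∃ P : X.maxCells, S.EndsAt P p := by
  simpa only [Sweep.reverse_startsAt] using hX.exists_startsAt S.reverse hp

theorem IsBalanced.two_le_card_cellsAt (hX : X.IsBalanced) {p : Plane} (hp : p ∈ X.verts) :
    2 ≤ (X.cellsAt p).card := by
  obtain ⟨S⟩ := X.nonempty_sweep
  obtain ⟨P, hP⟩ := hX.exists_startsAt S hp
  obtain ⟨Q, hQ⟩ := hX.exists_endsAt S hp
  refine Finset.one_lt_card.mpr ⟨P, mem_cellsAt.mpr hP.1, Q, mem_cellsAt.mpr hQ.1, ?_⟩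
  rintro rfl
  exact hP.not_endsAt hQ

theorem IsBalanced.affineSpan_eq_of_card_cellsAt (hX : X.IsBalanced) {p : Plane}
    (hp : p ∈ X.verts) (hcard : (X.cellsAt p).card = 2) {P Q : X.maxCells}
    (hP : p ∈ (P : Set Plane)) (hQ : p ∈ (Q : Set Plane)) :
    affineSpan ℝ (P : Set Plane) = affineSpan ℝ (Q : Set Plane) := by
  classical
  rcases eq_or_ne P Q with rfl | hPQ
  · rfl
  have hcells : X.cellsAt p = {P, Q} := by
    refine (Finset.eq_of_subset_of_card_le ?_ ?_).symm
    · simp [Finset.insert_subset_iff, mem_cellsAt, hP, hQ]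
    · rw [hcard, Finset.card_pair hPQ]
  obtain ⟨u, hu, hsum⟩ := hX.exists_directions hp
  rw [hcells, Finset.sum_pair hPQ, add_eq_zero_iff_eq_neg, ← neg_smul] at hsum
  obtain ⟨hu0, t, ht, hmem⟩ := hu P (mem_cellsAt.mpr hP)
  obtain ⟨hv0, r, hr, hmem'⟩ := hu Q (mem_cellsAt.mpr hQ)
  rw [affineSpan_eq_mk'_span_singleton (collinear_maxCell P) hP ht.ne' hu0
      (by rwa [vadd_eq_add, add_comm]),
    affineSpan_eq_mk'_span_singleton (collinear_maxCell Q) hQ hr.ne' hv0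
      (by rwa [vadd_eq_add, add_comm]),
    ← Submodule.span_singleton_smul_eq (IsUnit.mk0 _ (weight_maxCell_pos P).ne') (u P), hsum,
    Submodule.span_singleton_smul_eq (IsUnit.mk0 _ (neg_ne_zero.mpr (weight_maxCell_pos Q).ne'))]

open Classical in
/-- The vertices of degree two. In a balanced complex the two cells meeting at such a vertex lie on
a common line. -/
noncomputable def flatVerts (X : WeightedComplex) : Finset Plane :=
  {p ∈ X.verts | (X.cellsAt p).card = 2}

theorem mem_flatVerts {p : Plane} :
    p ∈ X.flatVerts ↔ p ∈ X.verts ∧ (X.cellsAt p).card = 2 := by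
  simp [flatVerts]

theorem IsBalanced.exists_not_startsAt_flatVerts (hX : X.IsBalanced) (S : X.Sweep)
    {L : AffineSubspace ℝ Plane} (hL : L ∈ X.spanLines) :
    ∃ P : X.maxCells, affineSpan ℝ (P : Set Plane) = L ∧ ∀ p ∈ X.flatVerts, ¬S.StartsAt P p := by
  classical
  by_contra! h
  obtain ⟨P₀, hP₀, hspan₀⟩ := Finset.mem_image.mp hL
  have : Nonempty {P : X.maxCells // affineSpan ℝ (P : Set Plane) = L} := ⟨⟨P₀, hP₀⟩, hspan₀⟩
  choose start hflat hstart using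
    fun P : {P : X.maxCells // affineSpan ℝ (P : Set Plane) = L} => h P P.2
  obtain ⟨P, hmin⟩ := Finite.exists_min fun P => S.absc (start P)
  obtain ⟨hvert, hcard⟩ := mem_flatVerts.mp (hflat P)
  obtain ⟨Q, hend⟩ := hX.exists_endsAt S hvert
  let Q' : {P : X.maxCells // affineSpan ℝ (P : Set Plane) = L} :=
    ⟨Q, (hX.affineSpan_eq_of_card_cellsAt hvert hcard hend.1 (hstart P).1).trans P.2⟩
  have heq : start Q' = start P :=
    S.injOn_absc Q (hstart Q').1 hend.1 (((hstart Q').2 hend.1).antisymm (hmin Q'))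
  exact (hstart Q').not_endsAt (heq ▸ hend)

theorem IsBalanced.card_spanLines_add_card_flatVerts_le (hX : X.IsBalanced) :
    X.spanLines.card + X.flatVerts.card ≤ X.maxCells.card := by
  classical
  obtain ⟨S⟩ := X.nonempty_sweep
  let startsFlat (P : X.maxCells) : Prop := ∃ p ∈ X.flatVerts, S.StartsAt P p
  have hflat : X.flatVerts.card ≤ (Finset.univ.filter startsFlat).card := by
    refine Finset.card_le_card_of_forall_subsingleton
      (fun (p : Plane) (P : X.maxCells) => S.StartsAt P p)
      (fun p hp => ?_) fun P _ p hp q hq => hp.2.eq hq.2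
    obtain ⟨P, hP⟩ := hX.exists_startsAt S (mem_flatVerts.mp hp).1
    exact ⟨P, Finset.mem_filter.mpr ⟨Finset.mem_univ P, p, hp, hP⟩, hP⟩
  have hlines : X.spanLines.card ≤ (Finset.univ.filter fun P => ¬startsFlat P).card := by
    refine Finset.card_le_card_of_forall_subsingleton
      (fun (L : AffineSubspace ℝ Plane) (P : X.maxCells) =>
        affineSpan ℝ (P : Set Plane) = L)
      (fun L hL => ?_) fun P _ L hL L' hL' => hL.2.symm.trans hL'.2
    obtain ⟨P, hPL, hP⟩ := hX.exists_not_startsAt_flatVerts S hL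
    exact ⟨P, by simpa [startsFlat] using hP, hPL⟩
  have hsplit := Finset.card_filter_add_card_filter_not (s := Finset.univ) startsFlat
  rw [Finset.card_univ, Fintype.card_coe] at hsplit
  omega

open Classical in
theorem card_verts_maxCell_le_two (P : X.maxCells) :
    (X.verts.filter (· ∈ (P : Set Plane))).card ≤ 2 := by
  obtain ⟨S⟩ := X.nonempty_sweep
  have hstart : (X.verts.filter (S.StartsAt P)).card ≤ 1 :=
    Finset.card_le_one.mpr fun p hp q hq =>
      (Finset.mem_filter.mp hp).2.eq (Finset.mem_filter.mp hq).2
  have hend : (X.verts.filter (S.EndsAt P)).card ≤ 1 :=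
    Finset.card_le_one.mpr fun p hp q hq =>
      (Finset.mem_filter.mp hp).2.eq (Finset.mem_filter.mp hq).2
  calc (X.verts.filter (· ∈ (P : Set Plane))).card
      ≤ (X.verts.filter fun p => S.StartsAt P p ∨ S.EndsAt P p).card :=
        Finset.card_le_card fun p hp => by
          obtain ⟨hpX, hpP⟩ := Finset.mem_filter.mp hp
          exact Finset.mem_filter.mpr ⟨hpX, S.startsAt_or_endsAt hpX hpP⟩
    _ ≤ 2 := by
        rw [Finset.filter_or]
        exact (Finset.card_union_le _ _).trans (Nat.add_le_add hstart hend)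

theorem sum_card_cellsAt_le (X : WeightedComplex) :
    ∑ p ∈ X.verts, (X.cellsAt p).card ≤ 2 * X.maxCells.card := by
  classical
  calc ∑ p ∈ X.verts, (X.cellsAt p).card
      = ∑ P : X.maxCells, (X.verts.filter (· ∈ (P : Set Plane))).card :=
        Finset.sum_card_bipartiteAbove_eq_sum_card_bipartiteBelow
          fun (p : Plane) (P : X.maxCells) => p ∈ (P : Set Plane)
    _ ≤ 2 * X.maxCells.card := by
        rw [mul_comm, ← Fintype.card_coe]
        exact Finset.sum_le_card_nsmul _ _ 2 fun P _ => card_verts_maxCell_le_two P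

theorem IsBalanced.three_mul_card_verts_le (hX : X.IsBalanced) :
    3 * X.verts.card ≤ 2 * X.maxCells.card + X.flatVerts.card := by
  classical
  have hdegree : ∀ p ∈ X.verts, 3 ≤ (X.cellsAt p).card + if (X.cellsAt p).card = 2 then 1 else 0 :=
    fun p hp => by
      have := hX.two_le_card_cellsAt hp
      split_ifs <;> omega
  have hsum := Finset.card_nsmul_le_sum X.verts _ 3 hdegree
  rw [Finset.sum_add_distrib, ← Finset.card_filter, smul_eq_mul, mul_comm] at hsum
  exact hsum.trans (Nat.add_le_add X.sum_card_cellsAt_le (by rw [flatVerts]))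

theorem IsBalanced.card_spanLines_add_three_le (hX : X.IsBalanced) :
    X.spanLines.card + 3 ≤ 3 * X.mlen := by
  have heuler := X.card_maxCells_lt_mlen_add_card_verts
  have hlines := hX.card_spanLines_add_card_flatVerts_le
  have hverts := hX.three_mul_card_verts_le
  omega

end WeightedComplex

theorem mlen_lineComplex_le_two (L : AffineSubspace ℝ Plane)
    (hL : Module.finrank ℝ L.direction = 1) (w : ℝ) (hw : 0 < w) :
    (lineComplex L hL w hw).mlen ≤ 2 := by
  classical
  have hcard : (lineComplex L hL w hw).maxCells.card ≤ 1 :=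
    (Finset.card_le_card (Finset.filter_subset _ _)).trans (Finset.card_singleton _).le
  exact (WeightedComplex.mlen_le_two_pow _).trans (Nat.pow_le_pow_right two_pos hcard)

theorem card_le_sum_map_card {α β : Type*} {s : Multiset α} {f : α → Finset β} {T : Finset β}
    (h : ∀ b ∈ T, ∃ a ∈ s, b ∈ f a) : T.card ≤ (s.map fun a => (f a).card).sum := by
  have hle : T.val ≤ s.bind fun a => (f a).val :=
    (Multiset.le_iff_subset T.nodup).mpr fun b hb => Multiset.mem_bind.mpr (h b hb)
  exact (Multiset.card_le_card hle).trans_eq (Multiset.card_bind _ _)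

namespace WeightedComplex

variable {X : WeightedComplex}

theorem flen_canonicalArrangement_le (X : WeightedComplex) :
    X.canonicalArrangement.flen ≤ X.spanLines.card + 1 := by
  have hcard : Multiset.card X.canonicalArrangement.factors = X.spanLines.card := by
    rw [canonicalArrangement, Multiset.card_map, Finset.card_val, Finset.card_attach]
  have hsum : (X.canonicalArrangement.factors.map fun Z => (Z.mlen : ℤ)).sum ≤
      Multiset.card (X.canonicalArrangement.factors.map fun Z => (Z.mlen : ℤ)) • (2 : ℤ) := by
    refine Multiset.sum_le_card_nsmul _ _ fun z hz => ?_
    obtain ⟨Z, hZ, rfl⟩ := Multiset.mem_map.mp hz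
    obtain ⟨L, -, rfl⟩ := Multiset.mem_map.mp hZ
    exact_mod_cast mlen_lineComplex_le_two _ _ _ _
  rw [Multiset.card_map, hcard, nsmul_eq_mul] at hsum
  rw [Factorization.flen, hcard]
  linarith

theorem weightAt_pos {P : X.maxCells} {x : Plane} (hx : x ∈ (P : Set Plane)) :
    0 < X.weightAt x := by
  classical
  exact Finset.sum_pos (fun Q hQ => weight_maxCell_pos ⟨Q, (Finset.mem_filter.mp hQ).1⟩)
    ⟨P, Finset.mem_filter.mpr ⟨P.2, hx⟩⟩

theorem exists_mem_maxCell_of_weightAt_ne_zero {x : Plane} (hx : X.weightAt x ≠ 0) :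
    ∃ P : X.maxCells, x ∈ (P : Set Plane) := by
  classical
  obtain ⟨P, hP, -⟩ := Finset.exists_ne_zero_of_sum_ne_zero hx
  obtain ⟨hP, hxP⟩ := Finset.mem_filter.mp hP
  exact ⟨⟨P, hP⟩, hxP⟩

end WeightedComplex

namespace Factorization

open WeightedComplex

variable {X : WeightedComplex} {V : Factorization}

theorem exists_mem_maxCell_of_weightAt_ne_zero {x : Plane} (hx : V.weightAt x ≠ 0) :
    ∃ Z ∈ V.factors, ∃ Q : Z.maxCells, x ∈ (Q : Set Plane) := by
  contrapose! hx
  refine Multiset.sum_eq_zero fun w hw => ?_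
  obtain ⟨Z, hZ, rfl⟩ := Multiset.mem_map.mp hw
  by_contra hne
  obtain ⟨Q, hQ⟩ := WeightedComplex.exists_mem_maxCell_of_weightAt_ne_zero hne
  exact hx Z hZ Q hQ

theorem IsBalancingOf.exists_infinite_inter (hV : V.IsBalancingOf X) (P : X.maxCells) :
    ∃ Z ∈ V.factors, ∃ Q : Z.maxCells, ((P : Set Plane) ∩ Q).Infinite := by
  classical
  by_contra! hfinite
  have hcover : (P : Set Plane) \ {x | ¬X.weightAt x ≤ V.weightAt x} ⊆
      ⋃ Z ∈ V.factors.toFinset, ⋃ Q : Z.maxCells, (P : Set Plane) ∩ Q := by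
    rintro x ⟨hxP, hx⟩
    obtain ⟨Z, hZ, Q, hxQ⟩ := exists_mem_maxCell_of_weightAt_ne_zero
      ((weightAt_pos hxP).trans_le (not_not.mp hx)).ne'
    exact Set.mem_biUnion (Multiset.mem_toFinset.mpr hZ) (Set.mem_iUnion.mpr ⟨Q, hxP, hxQ⟩)
  refine (infinite_maxCell P).sdiff (mem_cofinite.mp hV) (Set.Finite.subset ?_ hcover)
  exact V.factors.toFinset.finite_toSet.biUnion fun Z hZ =>
    Set.finite_iUnion fun Q => hfinite Z (Multiset.mem_toFinset.mp hZ) Q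

theorem IsBalancingOf.exists_mem_spanLines (hV : V.IsBalancingOf X)
    {L : AffineSubspace ℝ Plane} (hL : L ∈ X.spanLines) : ∃ Z ∈ V.factors, L ∈ Z.spanLines := by
  classical
  obtain ⟨P, hP, rfl⟩ := Finset.mem_image.mp hL
  obtain ⟨Z, hZ, Q, hPQ⟩ := hV.exists_infinite_inter ⟨P, hP⟩
  exact ⟨Z, hZ, Finset.mem_image.mpr ⟨Q, Q.2, (affineSpan_eq_of_nontrivial_inter
    (collinear_maxCell ⟨P, hP⟩) (collinear_maxCell Q) hPQ.nontrivial).symm⟩⟩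

theorem sum_card_spanLines_add_three_le (V : Factorization) :
    (((V.factors.map fun Z => Z.spanLines.card).sum : ℕ) : ℤ) + 3 ≤ 3 * V.flen := by
  have hfactors : (V.factors.map fun Z => Z.spanLines.card + 3).sum ≤
      (V.factors.map fun Z => 3 * Z.mlen).sum :=
    Multiset.sum_map_le_sum_map _ _ fun Z hZ => (V.balanced Z hZ).card_spanLines_add_three_le
  rw [Multiset.sum_map_add, Multiset.sum_map_mul_left, Multiset.map_const', Multiset.sum_replicate,
    smul_eq_mul] at hfactors
  have hcast : (V.factors.map fun Z => (Z.mlen : ℤ)).sum =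
      ((V.factors.map WeightedComplex.mlen).sum : ℕ) := by
    rw [Nat.cast_multiset_sum, Multiset.map_map]
    rfl
  rw [flen, hcast]
  omega

end Factorization

end PlaneComplex

theorem mainTheorem5_general (X : PlaneComplex.WeightedComplex) (V : PlaneComplex.Factorization)
    (hV : V.IsBalancingOf X) :
    X.canonicalArrangement.flen + 2 ≤ 3 * V.flen := by
  have harrangement := X.flen_canonicalArrangement_le
  have hlines := PlaneComplex.card_le_sum_map_card fun _ => hV.exists_mem_spanLines
  have hfactors := V.sum_card_spanLines_add_three_le
  omega

theorem mainTheorem5 (X : PlaneComplex.WeightedComplex) (V : PlaneComplex.Factorization)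
    (hV : V.IsMinimalBalancingOf X) :
    X.canonicalArrangement.flen ≤ 3 * V.flen := by
  have := mainTheorem5_general X V hV.1
  omega
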